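/- Let $A\in\mathbb{R}^{n\times n}$, $B\in\mathbb{R}^{n\times m}$, $C_p\in\mathbb{R}^{p\times n}$, $C_r\in\mathbb{R}^{r\times n}$ (the closed-loop matrices for one fixed sample of the uncertainty), with $A$ Hurwitz and $(A,B)$ controllable, and let $\epsilon_r,\epsilon_a\ge 0$. Consider the system $\dot x = Ax+Ba$, $y_p=C_px$, $y_r=C_rx$, $x(0)=0$, with inputs $a\in\mathcal{L}_{2e}$ (square integrable on every interval $[0,T]$), and the following two optimization problems. (D) Signal-space dual problem: take the infimum of $\epsilon_r\gamma_1+\epsilon_a\gamma_2$ over $\gamma_1,\gamma_2\ge 0$ such that, for every $a\in\mathcal{L}_{2e}$ and every $T\ge 0$, $$\int_0^T |y_p(t)|^2\,dt-\gamma_1\int_0^T |y_r(t)|^2\,dt-\gamma_2\int_0^T |a(t)|^2\,dt\le 0 .$$ (S) Semidefinite program: take the infimum of $\epsilon_r\gamma_1+\epsilon_a\gamma_2$ over symmetric $P\succ 0$ and $\gamma_1,\gamma_2\ge 0$ such that $$\begin{bmatrix}A^TP+PA+C_p^TC_p-\gamma_1C_r^TC_r & PB\\ B^TP & -\gamma_2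 I\end{bmatrix}\preceq 0 .$$ Then (D) and (S) are equivalent in the following sense. Problem (S) is feasible; if $(P,\gamma_1,\gamma_2)$ is feasible for (S), then $(\gamma_1,\gamma_2)$ is feasible for (D); if $(\gamma_1,\gamma_2)$ is feasible for (D), then for every $\varepsilon>0$ there is a $P$ such that $(P,\gamma_1,\gamma_2+\varepsilon)$ is feasible for (S); and (D) and (S) have the same optimal value. -/

import Mathlib

open scoped Matrix
open MeasureTheory

namespace LTI

variable {n m p r : Type*} [Fintype n] [DecidableEq n] [Fintype m] [DecidableEq m]
  [Fintype p] [Fintype r]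

/-- `A` is Hurwitz: every complex eigenvalue has negative real part, i.e. `ẋ = A x` is
asymptotically stable. -/
def IsHurwitz (A : Matrix n n ℝ) : Prop :=
  ∀ z ∈ spectrum ℂ (A.map (algebraMap ℝ ℂ)), z.re < 0

/-- The extended signal space `L_{2e}`: signals on `[0, ∞)` that are square integrable on every
bounded interval `[0, T]`. (Membership does not depend on the norm chosen on `ℝ^m`; values at
negative times are never used.) -/
def IsL2e (a : ℝ → m → ℝ) : Prop :=
  ∀ T : ℝ, MemLp a 2 (volume.restrict (Set.Icc 0 T))

/-- `x` is the state trajectory of `ẋ = A x + B a`, `x(0) = x₀`, on `[0, ∞)`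
(Carathéodory solution, i.e. `x` is continuous and satisfies the integral equation). -/
def IsTrajectory (A : Matrix n n ℝ) (B : Matrix n m ℝ) (x₀ : n → ℝ)
    (a : ℝ → m → ℝ) (x : ℝ → n → ℝ) : Prop :=
  ContinuousOn x (Set.Ici 0) ∧
    ∀ t : ℝ, 0 ≤ t → x t = x₀ + ∫ s in (0 : ℝ)..t, (A *ᵥ x s + B *ᵥ a s)

/-- Controllability of `(A, B)`: every state can be steered to every state in finite time. -/
def IsControllable (A : Matrix n n ℝ) (B : Matrix n m ℝ) : Prop :=
  ∀ x₀ x₁ : n → ℝ, ∃ T : ℝ, 0 ≤ T ∧ ∃ (a : ℝ → m → ℝ) (x : ℝ → n → ℝ),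
    IsL2e a ∧ IsTrajectory A B x₀ a x ∧ x T = x₁

/-- The energy `∫₀ᵀ |y(t)|² dt` (Euclidean norm) of a signal up to the horizon `T`. -/
noncomputable def energy (T : ℝ) (y : ℝ → m → ℝ) : ℝ :=
  ∫ t in (0 : ℝ)..T, y t ⬝ᵥ y t

/-- The multipliers `(γ₁, γ₂)` are feasible for the signal-space dual problem: they are
nonnegative and, along every trajectory from the origin driven by an input in `L_{2e}`,
`‖y_p‖² - γ₁ ‖y_r‖² - γ₂ ‖a‖² ≤ 0` on every finite horizon `[0, T]`, where `y_p = C_p x` and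
`y_r = C_r x`. -/
def DualFeasible (A : Matrix n n ℝ) (B : Matrix n m ℝ) (Cp : Matrix p n ℝ) (Cr : Matrix r n ℝ)
    (γ₁ γ₂ : ℝ) : Prop :=
  0 ≤ γ₁ ∧ 0 ≤ γ₂ ∧
    ∀ (a : ℝ → m → ℝ) (x : ℝ → n → ℝ), IsL2e a → IsTrajectory A B 0 a x →
      ∀ T : ℝ, 0 ≤ T →
        energy T (fun t => Cp *ᵥ x t) - γ₁ * energy T (fun t => Cr *ᵥ x t)
          - γ₂ * energy T a ≤ 0

/-- The matrix of the dissipation inequality. -/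
def dissipationMatrix (A : Matrix n n ℝ) (B : Matrix n m ℝ) (Cp : Matrix p n ℝ)
    (Cr : Matrix r n ℝ) (P : Matrix n n ℝ) (γ₁ γ₂ : ℝ) : Matrix (n ⊕ m) (n ⊕ m) ℝ :=
  Matrix.fromBlocks (Aᵀ * P + P * A + Cpᵀ * Cp - γ₁ • (Crᵀ * Cr)) (P * B)
    (Bᵀ * P) (-(γ₂ • (1 : Matrix m m ℝ)))

/-- `(P, γ₁, γ₂)` is feasible for the semidefinite program: `P ≻ 0`, `γ₁, γ₂ ≥ 0` and the
dissipation matrix is negative semidefinite. -/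
def SDPFeasible (A : Matrix n n ℝ) (B : Matrix n m ℝ) (Cp : Matrix p n ℝ) (Cr : Matrix r n ℝ)
    (P : Matrix n n ℝ) (γ₁ γ₂ : ℝ) : Prop :=
  P.PosDef ∧ 0 ≤ γ₁ ∧ 0 ≤ γ₂ ∧ (-dissipationMatrix A B Cp Cr P γ₁ γ₂).PosSemidef

/-- The optimal value of the signal-space dual problem (`⊤` if infeasible). -/
noncomputable def dualValue (A : Matrix n n ℝ) (B : Matrix n m ℝ) (Cp : Matrix p n ℝ)
    (Cr : Matrix r n ℝ) (εr εa : ℝ) : EReal :=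
  sInf {v : EReal | ∃ γ₁ γ₂ : ℝ, DualFeasible A B Cp Cr γ₁ γ₂ ∧
    v = ((εr * γ₁ + εa * γ₂ : ℝ) : EReal)}

/-- The optimal value of the semidefinite program (`⊤` if infeasible). -/
noncomputable def sdpValue (A : Matrix n n ℝ) (B : Matrix n m ℝ) (Cp : Matrix p n ℝ)
    (Cr : Matrix r n ℝ) (εr εa : ℝ) : EReal :=
  sInf {v : EReal | ∃ (P : Matrix n n ℝ) (γ₁ γ₂ : ℝ), SDPFeasible A B Cp Cr P γ₁ γ₂ ∧
    v = ((εr * γ₁ + εa * γ₂ : ℝ) : EReal)}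

end LTI

namespace LTI

/-! Read on stacked vectors (x, a), the matrix inequality says that the storage xᵀPx grows along
trajectories no faster than the supply γ₁|y_r|² + γ₂|a|² - |y_p|² accumulates (`sdpFeasible_iff`).
Integrating from x(0) = 0 and dropping x(T)ᵀPx(T) ≥ 0 gives the dual inequality.

The converse is Willems' argument. Let V(ξ) be the infimal supply spent in steering the origin to ξ.
Controllability makes this an infimum over a nonempty set, and dual feasibility bounds that set
below by 0. Linear dynamics and a quadratic supply make V homogeneous of degree two and subject to
the parallelogram inequality, so V(ξ) = ξᵀPξ with P ⪰ 0 (`exists_posSemidef_of_parallelogram`).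
Appending a trajectory to a steering shows that V is dissipated; differentiating at time 0 gives the
inequality at every (x, a).

This P may be singular. A Hurwitz A has a form P₀ ≻ 0 that decreases strictly up to the input energy
(`IsHurwitz.exists_posDef_dissipation`). Adding a small multiple of P₀ gives P ≻ 0 at the price of ε
in γ₂; a large multiple of P₀ alone shows that (S) is feasible. Letting ε → 0 equates the two
values. -/

theorem mulVec_dotProduct_self_le {n m : Type*} [Fintype n] [Fintype m]
    (K : Matrix m n ℝ) (v : n → ℝ) :
    (K *ᵥ v) ⬝ᵥ (K *ᵥ v) ≤ (∑ i, ∑ j, K i j ^ 2) * (v ⬝ᵥ v) := by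
  have h : ∀ i, (K *ᵥ v) i * (K *ᵥ v) i ≤ (∑ j, K i j ^ 2) * (v ⬝ᵥ v) := by
    intro i
    have := Finset.sum_mul_sq_le_sq_mul_sq Finset.univ (fun j => K i j) v
    simpa [Matrix.mulVec, dotProduct, pow_two] using this
  rw [Finset.sum_mul]
  exact Finset.sum_le_sum fun i _ => h i

theorem dotProduct_self_nonneg {n : Type*} [Fintype n] (v : n → ℝ) : 0 ≤ v ⬝ᵥ v :=
  Finset.sum_nonneg fun i _ => mul_self_nonneg (v i)

theorem exists_mulVec_bound {n m : Type*} [Fintype n] [Fintype m] (K : Matrix m n ℝ) :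
    ∃ κ : ℝ, 0 < κ ∧ ∀ v, (K *ᵥ v) ⬝ᵥ (K *ᵥ v) ≤ κ * (v ⬝ᵥ v) := by
  refine ⟨(∑ i, ∑ j, K i j ^ 2) + 1, by positivity, fun v => ?_⟩
  have := mulVec_dotProduct_self_le K v
  have := dotProduct_self_nonneg v
  linarith

/-! ### Lyapunov matrices through the Cayley transform -/

theorem IsHurwitz.isUnit_one_sub {n : Type*} [Fintype n] [DecidableEq n] {A : Matrix n n ℝ}
    (hA : IsHurwitz A) : IsUnit (1 - A) := by
  have h1 : (1 : ℂ) ∉ spectrum ℂ (A.map (algebraMap ℝ ℂ)) := fun h => by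
    have := hA 1 h
    simp at this
    linarith
  rw [spectrum.notMem_iff, map_one] at h1
  have h2 : (1 : Matrix n n ℂ) - A.map (algebraMap ℝ ℂ) = (algebraMap ℝ ℂ).mapMatrix (1 - A) := by
    rw [map_sub, map_one]; rfl
  rw [h2, Matrix.isUnit_iff_isUnit_det, ← RingHom.map_det, isUnit_iff_ne_zero] at h1
  rw [Matrix.isUnit_iff_isUnit_det, isUnit_iff_ne_zero]
  exact fun h => h1 (by rw [h, map_zero])

/-- The Cayley transform of a Hurwitz matrix has its spectrum in the open unit disc. -/
theorem IsHurwitz.norm_lt_one_of_mem_spectrum_cayley {n : Type*} [Fintype n] [DecidableEq n]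
    {A : Matrix n n ℝ} (hA : IsHurwitz A) {M : Matrix n n ℝ} (hM : M * (1 - A) = 1 + A)
    {z : ℂ} (hz : z ∈ spectrum ℂ (M.map (algebraMap ℝ ℂ))) : ‖z‖ < 1 := by
  by_contra! hz1
  refine hz ?_
  set Ac := A.map (algebraMap ℝ ℂ) with hAc
  set Mc := M.map (algebraMap ℝ ℂ) with hMc
  have hMA : Mc * (1 - Ac) = 1 + Ac := by
    have := congrArg (algebraMap ℝ ℂ).mapMatrix hM
    rwa [map_mul, map_sub, map_add, map_one] at this
  have hu : IsUnit (1 - Ac) := by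
    have := hA.isUnit_one_sub.map (algebraMap ℝ ℂ).mapMatrix
    rwa [map_sub, map_one] at this
  -- Multiplying by the invertible 1 - A clears the inverse in the Cayley transform; invertibility
  -- of z - M becomes that of (z - 1) - (z + 1)A.
  have key : (algebraMap ℂ (Matrix n n ℂ) z - Mc) * (1 - Ac)
      = (z - 1) • (1 : Matrix n n ℂ) - (z + 1) • Ac := by
    rw [sub_mul, hMA, Algebra.algebraMap_eq_smul_one]
    simp only [smul_mul_assoc, one_mul, smul_sub, sub_smul, add_smul, one_smul]
    abel
  have hunit : IsUnit ((algebraMap ℂ (Matrix n n ℂ) z - Mc) * (1 - Ac)) := by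
    rw [key]
    by_cases h : z + 1 = 0
    · have hz2 : z - 1 = -2 := by linear_combination h
      rw [h, hz2, zero_smul, sub_zero, ← Algebra.algebraMap_eq_smul_one]
      exact (IsUnit.mk0 (-2 : ℂ) (by norm_num)).map (algebraMap ℂ (Matrix n n ℂ))
    · have hw : ((z - 1) / (z + 1)) ∉ spectrum ℂ Ac := fun hw => by
        have h1 := hA _ hw
        -- For ‖z‖ ≥ 1 this real part is nonnegative, so the point cannot be an eigenvalue of A.
        have h2 : ((z - 1) / (z + 1)).re = (Complex.normSq z - 1) / Complex.normSq (z + 1) := by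
          rw [Complex.div_re, ← add_div]
          congr 1
          simp [Complex.normSq_apply]
          ring
        rw [h2, Complex.normSq_eq_norm_sq] at h1
        have h3 : (0:ℝ) ≤ ‖z‖ ^ 2 - 1 := by nlinarith
        exact absurd h1 (not_lt.2 (div_nonneg h3 (Complex.normSq_nonneg _)))
      rw [spectrum.notMem_iff, Algebra.algebraMap_eq_smul_one] at hw
      have h3 : (z - 1) • (1 : Matrix n n ℂ) - (z + 1) • Ac
          = (z + 1) • (((z - 1) / (z + 1)) • (1 : Matrix n n ℂ) - Ac) := by
        rw [smul_sub, smul_smul, mul_div_cancel₀ _ h]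
      rw [h3, ← Units.smul_mk0 h]
      exact (hw.smul (Units.mk0 _ h))
  obtain ⟨u, hu⟩ := hu
  rw [← hu] at hunit
  have h4 := hunit.mul u⁻¹.isUnit
  rwa [Units.mul_inv_cancel_right] at h4

section Frobenius

attribute [local instance] Matrix.frobeniusNormedRing Matrix.frobeniusNormedAlgebra

/-- Gelfand's formula: the spectral radius is below 1, so some power has Frobenius norm below 1, and
the square of that norm is the sum displayed. -/
theorem exists_pow_sum_sq_lt_one {n : Type*} [Fintype n] [DecidableEq n] [Nonempty n]
    {M : Matrix n n ℝ} (hM : ∀ z ∈ spectrum ℂ (M.map (algebraMap ℝ ℂ)), ‖z‖ < 1) :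
    ∃ N : ℕ, ∑ i, ∑ j, (M ^ N) i j ^ 2 < 1 := by
  set Mc := M.map (algebraMap ℝ ℂ) with hMc
  have : CompleteSpace (Matrix n n ℂ) := FiniteDimensional.complete ℂ _
  have h1 : spectralRadius ℂ Mc < (1 : NNReal) :=
    spectrum.spectralRadius_lt_of_forall_lt Mc fun z hz => by
      have := hM z hz
      exact_mod_cast this
  have h2 := (spectrum.pow_norm_pow_one_div_tendsto_nhds_spectralRadius Mc).eventually
    (eventually_lt_nhds h1)
  obtain ⟨N, hN, hN1⟩ := (h2.and (Filter.eventually_ge_atTop 1)).exists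
  refine ⟨N, ?_⟩
  have h3 : ‖Mc ^ N‖ ^ (1 / (N : ℝ)) < 1 := by
    rw [ENNReal.coe_one, ← ENNReal.ofReal_one] at hN
    exact (ENNReal.ofReal_lt_ofReal_iff one_pos).1 hN
  have h4 : ‖Mc ^ N‖ < 1 := by
    by_contra! h
    exact absurd h3 (not_lt.2 (Real.one_le_rpow h (by positivity)))
  have h5 : Mc ^ N = (M ^ N).map (algebraMap ℝ ℂ) :=
    (map_pow (algebraMap ℝ ℂ).mapMatrix M N).symm
  rw [h5, Matrix.frobenius_norm_def] at h4
  have h6 : ∑ i, ∑ j, ‖((M ^ N).map (algebraMap ℝ ℂ)) i j‖ ^ (2:ℝ) = ∑ i, ∑ j, (M ^ N) i j ^ 2 := by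
    simp
  rw [h6] at h4
  by_contra! h
  exact absurd h4 (not_lt.2 (Real.one_le_rpow h (by positivity)))

end Frobenius

theorem dotProduct_mulVec_comm_of_isSymm {n : Type*} [Fintype n] {S : Matrix n n ℝ}
    (hS : Sᵀ = S) (x y : n → ℝ) : x ⬝ᵥ S *ᵥ y = y ⬝ᵥ S *ᵥ x := by
  rw [Matrix.dotProduct_mulVec, dotProduct_comm, ← Matrix.mulVec_transpose, hS]

/-- A Hurwitz matrix has a positive definite strict Lyapunov matrix. -/
theorem IsHurwitz.exists_lyapunov {n : Type*} [Fintype n] [DecidableEq n] {A : Matrix n n ℝ}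
    (hA : IsHurwitz A) :
    ∃ P : Matrix n n ℝ, P.PosDef ∧ ∀ x, 2 * (x ⬝ᵥ P *ᵥ (A *ᵥ x)) ≤ -(x ⬝ᵥ x) := by
  rcases isEmpty_or_nonempty n with hn | hn
  · exact ⟨1, Matrix.PosDef.one, fun x => by simp [dotProduct]⟩
  have hdet := (Matrix.isUnit_iff_isUnit_det _).1 hA.isUnit_one_sub
  set R := (1 - A)⁻¹ with hR
  have hR1 : R * (1 - A) = 1 := Matrix.nonsing_inv_mul _ hdet
  set M := (1 + A) * R with hMdef
  have hM : M * (1 - A) = 1 + A := by rw [hMdef, mul_assoc, hR1, mul_one]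
  obtain ⟨N, hN⟩ := exists_pow_sum_sq_lt_one
    (fun z hz => hA.norm_lt_one_of_mem_spectrum_cayley hM hz)
  set θ := ∑ i, ∑ j, (M ^ N) i j ^ 2 with hθ
  obtain ⟨κ, hκ, hκb⟩ := exists_mulVec_bound R
  -- A truncation of the series solving the Stein equation. MᵀSM - S telescopes to (M ^ N)ᵀM ^ N -
  -- 1, which is already negative definite because θ < 1.
  set S : Matrix n n ℝ := ∑ k ∈ Finset.range N, (M ^ k)ᵀ * M ^ k with hS
  have hSsymm : Sᵀ = S := by
    simp [hS, Matrix.transpose_sum, Matrix.transpose_mul]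
  have hSq : ∀ x, x ⬝ᵥ S *ᵥ x = ∑ k ∈ Finset.range N, (M ^ k *ᵥ x) ⬝ᵥ (M ^ k *ᵥ x) := by
    intro x
    rw [hS, Matrix.sum_mulVec, dotProduct_sum]
    refine Finset.sum_congr rfl fun k _ => ?_
    rw [← Matrix.mulVec_mulVec, Matrix.dotProduct_mulVec, Matrix.vecMul_transpose]
  have hstein : ∀ x, (M *ᵥ x) ⬝ᵥ S *ᵥ (M *ᵥ x) - x ⬝ᵥ S *ᵥ x ≤ (θ - 1) * (x ⬝ᵥ x) := by
    intro x
    rw [hSq, hSq, ← Finset.sum_sub_distrib]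
    simp only [Matrix.mulVec_mulVec, ← pow_succ]
    rw [Finset.sum_range_sub (fun k => (M ^ k *ᵥ x) ⬝ᵥ (M ^ k *ᵥ x)), pow_zero, Matrix.one_mulVec]
    have := mulVec_dotProduct_self_le (M ^ N) x
    linarith
  have hlyap : ∀ u, 4 * (u ⬝ᵥ S *ᵥ (A *ᵥ u)) ≤ -((1 - θ) / κ) * (u ⬝ᵥ u) := by
    intro u
    -- With x = (1 - A)u one has Mx = (1 + A)u; the difference of the two values of S is 4 uᵀSAu by
    -- symmetry.
    have h1 := hstein ((1 - A) *ᵥ u)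
    rw [Matrix.mulVec_mulVec, hM] at h1
    have h2 := hκb ((1 - A) *ᵥ u)
    rw [Matrix.mulVec_mulVec, hR1, Matrix.one_mulVec] at h2
    have h3 := dotProduct_mulVec_comm_of_isSymm hSsymm u (A *ᵥ u)
    have h4 : (1 - θ) / κ * (u ⬝ᵥ u) ≤ (1 - θ) * (((1 - A) *ᵥ u) ⬝ᵥ ((1 - A) *ᵥ u)) := by
      rw [div_mul_eq_mul_div, div_le_iff₀ hκ]
      nlinarith
    simp only [Matrix.add_mulVec, Matrix.sub_mulVec, Matrix.one_mulVec, Matrix.mulVec_add,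
      Matrix.mulVec_sub, add_dotProduct, sub_dotProduct, dotProduct_add, dotProduct_sub]
      at h1 h4
    linarith
  -- For N = 0 the sum θ would be the dimension, hence at least 1. So S contains the term k = 0, the
  -- identity, and is definite.
  have hN0 : N ≠ 0 := by
    rintro rfl
    have : θ = ∑ i : n, (1 : ℝ) := by
      rw [hθ]
      refine Finset.sum_congr rfl fun i _ => ?_
      simp [Matrix.one_apply]
    rw [this, Finset.sum_const, Finset.card_univ, nsmul_one] at hN
    exact absurd (Nat.one_le_cast.2 Fintype.card_pos) (not_le.2 hN)
  have hSpos : S.PosDef := by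
    refine Matrix.PosDef.of_dotProduct_mulVec_pos ?_ fun x hx => ?_
    · rw [Matrix.IsHermitian, Matrix.conjTranspose_eq_transpose_of_trivial, hSsymm]
    · rw [star_trivial, hSq]
      refine Finset.sum_pos' (fun k _ => dotProduct_self_nonneg _)
        ⟨0, Finset.mem_range.2 (Nat.pos_of_ne_zero hN0), ?_⟩
      rw [pow_zero, Matrix.one_mulVec]
      exact lt_of_le_of_ne (dotProduct_self_nonneg x)
        fun h => hx (dotProduct_self_eq_zero.1 h.symm)
  have hc : 0 < 2 * κ / (1 - θ) := by
    have : 0 < 1 - θ := by linarith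
    positivity
  refine ⟨(2 * κ / (1 - θ)) • S, hSpos.smul hc, fun x => ?_⟩
  have h1 := mul_le_mul_of_nonneg_left (hlyap x) (show 0 ≤ κ / (1 - θ) by linarith [hc, mul_div_assoc 2 κ (1 - θ)])
  have h2 : κ / (1 - θ) * (-((1 - θ) / κ) * (x ⬝ᵥ x)) = -(x ⬝ᵥ x) := by
    have : 1 - θ ≠ 0 := by linarith
    field_simp
  rw [h2] at h1
  rw [Matrix.smul_mulVec, dotProduct_smul, smul_eq_mul]
  linear_combination h1

/-! ### The matrix inequality as a pointwise dissipation inequality -/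

/-- The supply rate `γ₁ |y_r|² + γ₂ |a|² - |y_p|²`. -/
noncomputable def supply {n m p r : Type*} [Fintype n] [Fintype m] [Fintype p] [Fintype r]
    (Cp : Matrix p n ℝ) (Cr : Matrix r n ℝ) (γ₁ γ₂ : ℝ) (x : n → ℝ) (a : m → ℝ) : ℝ :=
  γ₁ * ((Cr *ᵥ x) ⬝ᵥ (Cr *ᵥ x)) + γ₂ * (a ⬝ᵥ a) - (Cp *ᵥ x) ⬝ᵥ (Cp *ᵥ x)

theorem isHermitian_dissipationMatrix {n m p r : Type*} [Fintype n] [Fintype m]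
    [DecidableEq m] [Fintype p] [Fintype r] (A : Matrix n n ℝ) (B : Matrix n m ℝ)
    (Cp : Matrix p n ℝ) (Cr : Matrix r n ℝ) {P : Matrix n n ℝ} (hP : Pᵀ = P) (γ₁ γ₂ : ℝ) :
    (-dissipationMatrix A B Cp Cr P γ₁ γ₂).IsHermitian := by
  rw [Matrix.IsHermitian, Matrix.conjTranspose_eq_transpose_of_trivial]
  simp only [dissipationMatrix, Matrix.transpose_neg, Matrix.fromBlocks_transpose,
    Matrix.transpose_add, Matrix.transpose_sub, Matrix.transpose_mul, Matrix.transpose_smul,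
    Matrix.transpose_transpose, Matrix.transpose_one, hP]
  congr 2
  abel

theorem dotProduct_dissipationMatrix {n m p r : Type*} [Fintype n] [Fintype m]
    [DecidableEq m] [Fintype p] [Fintype r] (A : Matrix n n ℝ) (B : Matrix n m ℝ)
    (Cp : Matrix p n ℝ) (Cr : Matrix r n ℝ) {P : Matrix n n ℝ} (hP : Pᵀ = P) (γ₁ γ₂ : ℝ)
    (x : n → ℝ) (a : m → ℝ) :
    (Sum.elim x a) ⬝ᵥ (-dissipationMatrix A B Cp Cr P γ₁ γ₂) *ᵥ (Sum.elim x a)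
      = supply Cp Cr γ₁ γ₂ x a - 2 * (x ⬝ᵥ P *ᵥ (A *ᵥ x + B *ᵥ a)) := by
  have h1 : x ⬝ᵥ (Aᵀ * P) *ᵥ x = x ⬝ᵥ P *ᵥ (A *ᵥ x) := by
    rw [← Matrix.mulVec_mulVec, Matrix.dotProduct_mulVec, Matrix.vecMul_transpose,
      dotProduct_mulVec_comm_of_isSymm hP]
  have h2 : a ⬝ᵥ (Bᵀ * P) *ᵥ x = x ⬝ᵥ P *ᵥ (B *ᵥ a) := by
    rw [← Matrix.mulVec_mulVec, Matrix.dotProduct_mulVec, Matrix.vecMul_transpose,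
      dotProduct_mulVec_comm_of_isSymm hP]
  have h3 : x ⬝ᵥ (Cpᵀ * Cp) *ᵥ x = (Cp *ᵥ x) ⬝ᵥ (Cp *ᵥ x) := by
    rw [← Matrix.mulVec_mulVec, Matrix.dotProduct_mulVec, Matrix.vecMul_transpose]
  have h4 : x ⬝ᵥ (Crᵀ * Cr) *ᵥ x = (Cr *ᵥ x) ⬝ᵥ (Cr *ᵥ x) := by
    rw [← Matrix.mulVec_mulVec, Matrix.dotProduct_mulVec, Matrix.vecMul_transpose]
  rw [dissipationMatrix, Matrix.neg_mulVec, dotProduct_neg, Matrix.fromBlocks_mulVec,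
    sumElim_dotProduct_sumElim]
  simp only [Sum.elim_comp_inl, Sum.elim_comp_inr, Matrix.add_mulVec, Matrix.sub_mulVec,
    Matrix.neg_mulVec, Matrix.smul_mulVec, Matrix.one_mulVec, dotProduct_add, dotProduct_sub,
    dotProduct_neg, dotProduct_smul, smul_eq_mul, h1, h2, h3, h4, Matrix.mulVec_add, supply]
  simp only [← Matrix.mulVec_mulVec]
  ring

theorem sdpFeasible_iff {n m p r : Type*} [Fintype n] [Fintype m]
    [DecidableEq m] [Fintype p] [Fintype r] {A : Matrix n n ℝ} {B : Matrix n m ℝ}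
    {Cp : Matrix p n ℝ} {Cr : Matrix r n ℝ} {P : Matrix n n ℝ} {γ₁ γ₂ : ℝ} :
    SDPFeasible A B Cp Cr P γ₁ γ₂ ↔ P.PosDef ∧ 0 ≤ γ₁ ∧ 0 ≤ γ₂ ∧
      ∀ x a, 2 * (x ⬝ᵥ P *ᵥ (A *ᵥ x + B *ᵥ a)) ≤ supply Cp Cr γ₁ γ₂ x a := by
  refine and_congr_right fun hP => and_congr_right fun _ => and_congr_right fun _ => ?_
  have hPt : Pᵀ = P := by
    rw [← Matrix.conjTranspose_eq_transpose_of_trivial]; exact hP.isHermitian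
  constructor
  · intro h x a
    have := h.dotProduct_mulVec_nonneg (Sum.elim x a)
    rw [star_trivial, dotProduct_dissipationMatrix A B Cp Cr hPt] at this
    linarith
  · intro h
    refine .of_dotProduct_mulVec_nonneg (isHermitian_dissipationMatrix A B Cp Cr hPt γ₁ γ₂)
      fun z => ?_
    rw [star_trivial, ← Sum.elim_comp_inl_inr z, dotProduct_dissipationMatrix A B Cp Cr hPt]
    linarith [h (z ∘ Sum.inl) (z ∘ Sum.inr)]

/-- Young's inequality, weighted so that the cross term with the input consumes only half of the
Lyapunov decrease. -/
theorem two_mul_dotProduct_le {n : Type*} [Fintype n] (x y : n → ℝ) :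
    2 * (x ⬝ᵥ y) ≤ (1 / 2) * (x ⬝ᵥ x) + 2 * (y ⬝ᵥ y) := by
  simp only [dotProduct, Finset.mul_sum, ← Finset.sum_add_distrib]
  exact Finset.sum_le_sum fun i _ => by nlinarith [sq_nonneg (x i - 2 * y i)]

/-- Along `ẋ = A x + B a` with `A` Hurwitz, some positive definite form decreases strictly up to
the energy of the input. -/
theorem IsHurwitz.exists_posDef_dissipation {n m : Type*} [Fintype n] [DecidableEq n] [Fintype m]
    {A : Matrix n n ℝ} (hA : IsHurwitz A) (B : Matrix n m ℝ) :
    ∃ P : Matrix n n ℝ, P.PosDef ∧ ∃ κ : ℝ, 0 < κ ∧ ∀ x a,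
      2 * (x ⬝ᵥ P *ᵥ (A *ᵥ x + B *ᵥ a)) ≤ -(1 / 2) * (x ⬝ᵥ x) + κ * (a ⬝ᵥ a) := by
  obtain ⟨P, hP, hPA⟩ := hA.exists_lyapunov
  obtain ⟨κ, hκ, hκb⟩ := exists_mulVec_bound (P * B)
  refine ⟨P, hP, 2 * κ, by positivity, fun x a => ?_⟩
  have h1 := hPA x
  have h2 := two_mul_dotProduct_le x ((P * B) *ᵥ a)
  have h3 := hκb a
  rw [Matrix.mulVec_add, dotProduct_add]
  rw [← Matrix.mulVec_mulVec] at h2 h3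
  linarith

theorem IsHurwitz.exists_sdpFeasible {n m p r : Type*} [Fintype n] [DecidableEq n] [Fintype m]
    [DecidableEq m] [Fintype p] [Fintype r] {A : Matrix n n ℝ} (hA : IsHurwitz A)
    (B : Matrix n m ℝ) (Cp : Matrix p n ℝ) (Cr : Matrix r n ℝ) :
    ∃ (P : Matrix n n ℝ) (γ₁ γ₂ : ℝ), SDPFeasible A B Cp Cr P γ₁ γ₂ := by
  obtain ⟨P, hP, κ, hκ, h⟩ := hA.exists_posDef_dissipation B
  obtain ⟨c, hc, hcb⟩ := exists_mulVec_bound Cp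
  -- The factor 2c turns the decrease |x|²/2 into c|x|², which dominates |C_p x|²; hence γ₁ = 0
  -- suffices.
  refine ⟨(2 * c) • P, 0, 2 * c * κ, sdpFeasible_iff.2
    ⟨hP.smul (by positivity), le_rfl, by positivity, fun x a => ?_⟩⟩
  have h1 := mul_le_mul_of_nonneg_left (h x a) (show 0 ≤ 2 * c by positivity)
  have h2 := hcb x
  rw [Matrix.smul_mulVec, dotProduct_smul, smul_eq_mul, supply]
  linarith

/-- A positive semidefinite storage matrix can be made positive definite at the price of an
arbitrarily small increase of `γ₂`. -/
theorem IsHurwitz.exists_sdpFeasible_add {n m p r : Type*} [Fintype n] [DecidableEq n] [Fintype m]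
    [DecidableEq m] [Fintype p] [Fintype r] {A : Matrix n n ℝ} (hA : IsHurwitz A)
    {B : Matrix n m ℝ} {Cp : Matrix p n ℝ} {Cr : Matrix r n ℝ} {P : Matrix n n ℝ}
    (hP : P.PosSemidef) {γ₁ γ₂ : ℝ} (h₁ : 0 ≤ γ₁) (h₂ : 0 ≤ γ₂)
    (h : ∀ x a, 2 * (x ⬝ᵥ P *ᵥ (A *ᵥ x + B *ᵥ a)) ≤ supply Cp Cr γ₁ γ₂ x a)
    {ε : ℝ} (hε : 0 < ε) :
    ∃ P : Matrix n n ℝ, SDPFeasible A B Cp Cr P γ₁ (γ₂ + ε) := by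
  obtain ⟨P₀, hP₀, κ, hκ, h0⟩ := hA.exists_posDef_dissipation B
  have hδ : 0 < ε / κ := by positivity
  -- The multiple ε / κ makes the input cost κ|a|² of P₀ exactly ε|a|².
  refine ⟨P + (ε / κ) • P₀, sdpFeasible_iff.2
    ⟨Matrix.PosDef.posSemidef_add hP (hP₀.smul hδ), h₁, by positivity, fun x a => ?_⟩⟩
  have e1 := mul_le_mul_of_nonneg_left (h0 x a) hδ.le
  have e2 : ε / κ * (κ * (a ⬝ᵥ a)) = ε * (a ⬝ᵥ a) := by field_simp
  have e3 := mul_nonneg hδ.le (dotProduct_self_nonneg x)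
  have e4 := h x a
  rw [supply] at e4
  rw [Matrix.add_mulVec, Matrix.smul_mulVec, dotProduct_add, dotProduct_smul, smul_eq_mul, supply]
  linarith

/-! ### Integrability of inputs, velocities and supplies -/

theorem IsL2e.memLp_eval {m : Type*} [Fintype m] {a : ℝ → m → ℝ} (ha : IsL2e a) (T : ℝ) (i : m) :
    MemLp (fun t => a t i) 2 (volume.restrict (Set.Icc 0 T)) :=
  memLp_pi_iff.1 (ha T) i

theorem IsL2e.intervalIntegrable {m : Type*} [Fintype m] {a : ℝ → m → ℝ} (ha : IsL2e a)
    {T : ℝ} (hT : 0 ≤ T) : IntervalIntegrable a volume 0 T := by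
  rw [intervalIntegrable_iff_integrableOn_Icc_of_le hT]
  exact (ha T).integrable (by norm_num)

theorem IsL2e.intervalIntegrable_dotProduct_self {m : Type*} [Fintype m] {a : ℝ → m → ℝ}
    (ha : IsL2e a) {T : ℝ} (hT : 0 ≤ T) :
    IntervalIntegrable (fun t => a t ⬝ᵥ a t) volume 0 T := by
  rw [intervalIntegrable_iff_integrableOn_Icc_of_le hT]
  exact integrable_finsetSum _ fun i _ => (ha.memLp_eval T i).integrable_mul (ha.memLp_eval T i)

theorem _root_.Continuous.isL2e {m : Type*} [Fintype m] {a : ℝ → m → ℝ} (ha : Continuous a) :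
    IsL2e a := fun T => by
  obtain ⟨C, hC⟩ := isCompact_Icc.exists_bound_of_continuousOn (ha.continuousOn (s := Set.Icc 0 T))
  exact MemLp.of_bound ha.aestronglyMeasurable C ((ae_restrict_iff' measurableSet_Icc).2 (ae_of_all _ hC))

theorem _root_.ContinuousOn.mulVec_const {X n m : Type*} [TopologicalSpace X] [Fintype n]
    {x : X → n → ℝ} {s : Set X} (hx : ContinuousOn x s) (K : Matrix m n ℝ) :
    ContinuousOn (fun t => K *ᵥ x t) s :=
  (Continuous.matrix_mulVec continuous_const continuous_id).comp_continuousOn hx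

theorem _root_.ContinuousOn.dotProduct' {X n : Type*} [TopologicalSpace X] [Fintype n]
    {x y : X → n → ℝ} {s : Set X} (hx : ContinuousOn x s) (hy : ContinuousOn y s) :
    ContinuousOn (fun t => x t ⬝ᵥ y t) s :=
  continuousOn_finsetSum _ fun i _ =>
    ((continuous_apply i).comp_continuousOn hx).mul ((continuous_apply i).comp_continuousOn hy)

theorem intervalIntegrable_of_continuousOn_Ici {E : Type*} [NormedAddCommGroup E] {f : ℝ → E}
    (hf : ContinuousOn f (Set.Ici 0)) {T : ℝ} (hT : 0 ≤ T) : IntervalIntegrable f volume 0 T :=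
  (hf.mono (by rw [Set.uIcc_of_le hT]; exact Set.Icc_subset_Ici_self)).intervalIntegrable

theorem intervalIntegrable_mulVec {n m : Type*} [Fintype n] [Fintype m] {a : ℝ → n → ℝ}
    {s t : ℝ} (ha : IntervalIntegrable a volume s t) (K : Matrix m n ℝ) :
    IntervalIntegrable (fun τ => K *ᵥ a τ) volume s t := by
  exact ⟨(LinearMap.toContinuousLinearMap (Matrix.mulVecLin K)).integrable_comp ha.1,
    (LinearMap.toContinuousLinearMap (Matrix.mulVecLin K)).integrable_comp ha.2⟩

theorem intervalIntegral_mulVec {n m : Type*} [Fintype n] [Fintype m] {a : ℝ → n → ℝ}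
    {s t : ℝ} (ha : IntervalIntegrable a volume s t) (K : Matrix m n ℝ) :
    ∫ τ in s..t, K *ᵥ a τ = K *ᵥ ∫ τ in s..t, a τ :=
  (LinearMap.toContinuousLinearMap (Matrix.mulVecLin K)).intervalIntegral_comp_comm ha

theorem intervalIntegrable_velocity {n m : Type*} [Fintype n] [Fintype m] (A : Matrix n n ℝ)
    (B : Matrix n m ℝ) {a : ℝ → m → ℝ} {x : ℝ → n → ℝ} (ha : IsL2e a)
    (hx : ContinuousOn x (Set.Ici 0)) {T : ℝ} (hT : 0 ≤ T) :
    IntervalIntegrable (fun t => A *ᵥ x t + B *ᵥ a t) volume 0 T :=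
  (intervalIntegrable_mulVec (intervalIntegrable_of_continuousOn_Ici hx hT) A).add
    (intervalIntegrable_mulVec (ha.intervalIntegrable hT) B)

theorem intervalIntegrable_output {n p : Type*} [Fintype n] [Fintype p] (C : Matrix p n ℝ)
    {x : ℝ → n → ℝ} (hx : ContinuousOn x (Set.Ici 0)) {T : ℝ} (hT : 0 ≤ T) :
    IntervalIntegrable (fun t => (C *ᵥ x t) ⬝ᵥ (C *ᵥ x t)) volume 0 T :=
  intervalIntegrable_of_continuousOn_Ici ((hx.mulVec_const C).dotProduct' (hx.mulVec_const C)) hT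

section Supply

variable {n m p r : Type*} [Fintype n] [Fintype m] [Fintype p] [Fintype r]

theorem intervalIntegrable_supply (Cp : Matrix p n ℝ) (Cr : Matrix r n ℝ) (γ₁ γ₂ : ℝ)
    {a : ℝ → m → ℝ} {x : ℝ → n → ℝ} (ha : IsL2e a) (hx : ContinuousOn x (Set.Ici 0))
    {T : ℝ} (hT : 0 ≤ T) :
    IntervalIntegrable (fun t => supply Cp Cr γ₁ γ₂ (x t) (a t)) volume 0 T :=
  (((intervalIntegrable_output Cr hx hT).const_mul γ₁).add
    ((ha.intervalIntegrable_dotProduct_self hT).const_mul γ₂)).sub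
      (intervalIntegrable_output Cp hx hT)

theorem integral_supply (Cp : Matrix p n ℝ) (Cr : Matrix r n ℝ) (γ₁ γ₂ : ℝ)
    {a : ℝ → m → ℝ} {x : ℝ → n → ℝ} (ha : IsL2e a) (hx : ContinuousOn x (Set.Ici 0))
    {T : ℝ} (hT : 0 ≤ T) :
    ∫ t in (0 : ℝ)..T, supply Cp Cr γ₁ γ₂ (x t) (a t)
      = γ₁ * energy T (fun t => Cr *ᵥ x t) + γ₂ * energy T a - energy T (fun t => Cp *ᵥ x t) := by
  have h1 := (intervalIntegrable_output Cr hx hT).const_mul γ₁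
  have h2 := (ha.intervalIntegrable_dotProduct_self hT).const_mul γ₂
  have h3 := intervalIntegrable_output Cp hx hT
  simp only [supply, energy]
  rw [intervalIntegral.integral_sub (h1.add h2) h3, intervalIntegral.integral_add h1 h2,
    intervalIntegral.integral_const_mul, intervalIntegral.integral_const_mul]

end Supply

/-! ### Energy balance, and from (S) to (D) -/

/-- Integration by parts for absolutely continuous functions: with merely integrable velocities, the
primitives are differentiable only almost everywhere. -/
theorem integral_mul_add_mul_primitive {f g : ℝ → ℝ} {T : ℝ}
    (hf : IntervalIntegrable f volume 0 T) (hg : IntervalIntegrable g volume 0 T) :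
    ∫ t in (0 : ℝ)..T, (f t * (∫ s in (0 : ℝ)..t, g s) + (∫ s in (0 : ℝ)..t, f s) * g t)
      = (∫ s in (0 : ℝ)..T, f s) * ∫ s in (0 : ℝ)..T, g s := by
  have hF := hf.absolutelyContinuousOnInterval_intervalIntegral (c := 0) Set.left_mem_uIcc
  have hG := hg.absolutelyContinuousOnInterval_intervalIntegral (c := 0) Set.left_mem_uIcc
  have h := hF.integral_deriv_mul_eq_sub hG
  rw [intervalIntegral.integral_same, zero_mul, sub_zero] at h
  rw [← h]
  apply intervalIntegral.integral_congr_ae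
  filter_upwards [hf.ae_hasDerivAt_integral, hg.ae_hasDerivAt_integral] with t h1 h2 ht
  have ht' := Set.uIoc_subset_uIcc ht
  rw [(h1 ht' 0 Set.left_mem_uIcc).deriv, (h2 ht' 0 Set.left_mem_uIcc).deriv]

theorem intervalIntegrable_eval {n : Type*} [Fintype n] {f : ℝ → n → ℝ} {s t : ℝ}
    (hf : IntervalIntegrable f volume s t) (i : n) :
    IntervalIntegrable (fun τ => f τ i) volume s t :=
  ⟨(ContinuousLinearMap.proj (R := ℝ) (φ := fun _ : n => ℝ) i).integrable_comp hf.1,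
    (ContinuousLinearMap.proj (R := ℝ) (φ := fun _ : n => ℝ) i).integrable_comp hf.2⟩

theorem intervalIntegral_eval {n : Type*} [Fintype n] {f : ℝ → n → ℝ} {s t : ℝ}
    (hf : IntervalIntegrable f volume s t) (i : n) :
    ∫ τ in s..t, f τ i = (∫ τ in s..t, f τ) i :=
  (ContinuousLinearMap.proj (R := ℝ) (φ := fun _ : n => ℝ) i).intervalIntegral_comp_comm hf

/-- Energy balance for a quadratic form along a trajectory from the origin. -/
theorem IsTrajectory.integral_quadratic {n m : Type*} [Fintype n] [Fintype m] {A : Matrix n n ℝ}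
    {B : Matrix n m ℝ} {a : ℝ → m → ℝ} {x : ℝ → n → ℝ} (ha : IsL2e a)
    (hx : IsTrajectory A B 0 a x) {P : Matrix n n ℝ} (hP : Pᵀ = P) {T : ℝ} (hT : 0 ≤ T) :
    IntervalIntegrable (fun t => 2 * (x t ⬝ᵥ P *ᵥ (A *ᵥ x t + B *ᵥ a t))) volume 0 T ∧
    ∫ t in (0 : ℝ)..T, 2 * (x t ⬝ᵥ P *ᵥ (A *ᵥ x t + B *ᵥ a t)) = x T ⬝ᵥ P *ᵥ x T := by
  set f := fun t => A *ᵥ x t + B *ᵥ a t with hf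
  have hfi : ∀ t, 0 ≤ t → IntervalIntegrable f volume 0 t := fun t ht =>
    intervalIntegrable_velocity A B ha hx.1 ht
  have hgi : ∀ t, 0 ≤ t → IntervalIntegrable (fun t => P *ᵥ f t) volume 0 t := fun t ht =>
    intervalIntegrable_mulVec (hfi t ht) P
  have hxi : ∀ t, 0 ≤ t → ∀ i, x t i = ∫ s in (0 : ℝ)..t, f s i := fun t ht i => by
    rw [intervalIntegral_eval (hfi t ht), hx.2 t ht, zero_add]
  have hPxi : ∀ t, 0 ≤ t → ∀ i, (P *ᵥ x t) i = ∫ s in (0 : ℝ)..t, (P *ᵥ f s) i := fun t ht i => by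
    rw [intervalIntegral_eval (hgi t ht), intervalIntegral_mulVec (hfi t ht), hx.2 t ht, zero_add]
  have hcont : ∀ {g : ℝ → ℝ}, ContinuousOn g (Set.Ici 0) → ContinuousOn g (Set.uIcc 0 T) :=
    fun hg => hg.mono (by rw [Set.uIcc_of_le hT]; exact Set.Icc_subset_Ici_self)
  have hint : ∀ i, IntervalIntegrable
      (fun t => f t i * (P *ᵥ x t) i + x t i * (P *ᵥ f t) i) volume 0 T := fun i =>
    ((intervalIntegrable_eval (hfi T hT) i).mul_continuousOn
      (hcont ((continuous_apply i).comp_continuousOn (hx.1.mulVec_const P)))).add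
    ((intervalIntegrable_eval (hgi T hT) i).continuousOn_mul
      (hcont ((continuous_apply i).comp_continuousOn hx.1)))
  have hsum : (fun t => 2 * (x t ⬝ᵥ P *ᵥ f t))
      = fun t => ∑ i, (f t i * (P *ᵥ x t) i + x t i * (P *ᵥ f t) i) := by
    funext t
    rw [Finset.sum_add_distrib, two_mul]
    exact congrArg (· + _) (dotProduct_mulVec_comm_of_isSymm hP _ _)
  rw [hsum]
  refine ⟨by
    simpa only [Finset.sum_fn] using IntervalIntegrable.sum Finset.univ (fun i _ => hint i), ?_⟩
  rw [intervalIntegral.integral_finsetSum fun i _ => hint i]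
  refine Finset.sum_congr rfl fun i _ => ?_
  rw [hxi T hT, hPxi T hT, ← integral_mul_add_mul_primitive
    (intervalIntegrable_eval (hfi T hT) i) (intervalIntegrable_eval (hgi T hT) i)]
  refine intervalIntegral.integral_congr fun t ht => ?_
  rw [Set.uIcc_of_le hT] at ht
  simp only [hxi t ht.1 i, hPxi t ht.1 i]

theorem SDPFeasible.dualFeasible {n m p r : Type*} [Fintype n] [Fintype m]
    [DecidableEq m] [Fintype p] [Fintype r] {A : Matrix n n ℝ} {B : Matrix n m ℝ}
    {Cp : Matrix p n ℝ} {Cr : Matrix r n ℝ} {P : Matrix n n ℝ} {γ₁ γ₂ : ℝ}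
    (h : SDPFeasible A B Cp Cr P γ₁ γ₂) : DualFeasible A B Cp Cr γ₁ γ₂ := by
  obtain ⟨hP, h₁, h₂, h⟩ := sdpFeasible_iff.1 h
  refine ⟨h₁, h₂, fun a x ha hx T hT => ?_⟩
  have hPt : Pᵀ = P := by
    rw [← Matrix.conjTranspose_eq_transpose_of_trivial]; exact hP.isHermitian
  obtain ⟨hi, he⟩ := hx.integral_quadratic ha hPt hT
  have h3 := intervalIntegral.integral_mono_on hT hi
    (intervalIntegrable_supply Cp Cr γ₁ γ₂ ha hx.1 hT) fun t _ => h (x t) (a t)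
  rw [he, integral_supply Cp Cr γ₁ γ₂ ha hx.1 hT] at h3
  have h4 := hP.posSemidef.dotProduct_mulVec_nonneg (x T)
  rw [star_trivial] at h4
  linarith

/-! ### Quadratic forms from the parallelogram inequality (Jordan–von Neumann) -/

section Parallelogram

variable {E : Type*} [AddCommGroup E] [Module ℝ E] {V : E → ℝ}

/-- The inequality applied to x + y and x - y, whose sum and difference are 2x and 2y, is the
reverse inequality. -/
theorem parallelogram_eq_of_le (hhom : ∀ (c : ℝ) x, V (c • x) = c ^ 2 * V x)
    (hpar : ∀ x y, V (x + y) + V (x - y) ≤ 2 * V x + 2 * V y) (x y : E) :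
    V (x + y) + V (x - y) = 2 * V x + 2 * V y := by
  refine le_antisymm (hpar x y) ?_
  have h := hpar (x + y) (x - y)
  rw [show x + y + (x - y) = (2 : ℝ) • x by rw [two_smul]; abel,
    show x + y - (x - y) = (2 : ℝ) • y by rw [two_smul]; abel, hhom, hhom] at h
  linarith

theorem polar_add_left (hhom : ∀ (c : ℝ) x, V (c • x) = c ^ 2 * V x)
    (hpar : ∀ x y, V (x + y) + V (x - y) = 2 * V x + 2 * V y) (x z y : E) :
    V (x + z + y) - V (x + z - y) = (V (x + y) - V (x - y)) + (V (z + y) - V (z - y)) := by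
  have hneg : ∀ x, V (-x) = V x := fun x => by simpa using hhom (-1) x
  have key : ∀ u v : E, (V (u + v + y) - V (u + v - y)) + (V (u - v + y) - V (u - v - y))
      = 2 * (V (u + y) - V (u - y)) := by
    intro u v
    have h1 := hpar (u + y) v
    have h2 := hpar (u - y) v
    rw [show u + y + v = u + v + y by abel, show u + y - v = u - v + y by abel] at h1
    rw [show u - y + v = u + v - y by abel, show u - y - v = u - v - y by abel] at h2
    linarith
  have hdouble : ∀ u : E, V (u + u + y) - V (u + u - y) = 2 * (V (u + y) - V (u - y)) := by
    intro u
    have h := key u u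
    rw [sub_self, zero_add, zero_sub, hneg] at h
    linarith
  -- With u and v the half sum and half difference, u + v = x, u - v = z and 2u = x + z.
  have h1 := key ((1 / 2 : ℝ) • (x + z)) ((1 / 2 : ℝ) • (x - z))
  have h2 := hdouble ((1 / 2 : ℝ) • (x + z))
  have e1 : (1 / 2 : ℝ) • (x + z) + (1 / 2 : ℝ) • (x - z) = x := by module
  have e2 : (1 / 2 : ℝ) • (x + z) - (1 / 2 : ℝ) • (x - z) = z := by module
  have e3 : (1 / 2 : ℝ) • (x + z) + (1 / 2 : ℝ) • (x + z) = x + z := by module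
  rw [e1, e2] at h1
  rw [e3] at h2
  linarith

/-- In the scalar the polar form is additive, and nonnegativity of V with the parallelogram law
bounds it near 0. It is therefore continuous, hence real-linear. -/
theorem polar_smul_left (hnonneg : ∀ x, 0 ≤ V x) (hhom : ∀ (c : ℝ) x, V (c • x) = c ^ 2 * V x)
    (hpar : ∀ x y, V (x + y) + V (x - y) = 2 * V x + 2 * V y) (c : ℝ) (x y : E) :
    V (c • x + y) - V (c • x - y) = c * (V (x + y) - V (x - y)) := by
  let f : ℝ →+ ℝ := AddMonoidHom.mk' (fun t => V (t • x + y) - V (t • x - y)) fun s t => by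
    rw [add_smul, polar_add_left hhom hpar]
  have hf : Continuous f := by
    refine f.continuous_of_isBounded_nhds_zero (Metric.ball_mem_nhds 0 one_pos) ?_
    refine isBounded_iff_forall_norm_le.2 ⟨2 * V x + 2 * V y, ?_⟩
    rintro _ ⟨t, ht, rfl⟩
    have h1 := hpar (t • x) y
    rw [hhom] at h1
    have h2 := hnonneg (t • x + y)
    have h3 := hnonneg (t • x - y)
    have h4 := hnonneg x
    have h5 : t ^ 2 ≤ 1 := by
      rw [sq_le_one_iff_abs_le_one]
      simpa using (mem_ball_zero_iff.1 ht).le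
    have h6 : t ^ 2 * V x ≤ V x := mul_le_of_le_one_left h4 h5
    rw [Real.norm_eq_abs, abs_le]
    change -_ ≤ V (t • x + y) - V (t • x - y) ∧ V (t • x + y) - V (t • x - y) ≤ _
    constructor <;> linarith
  have h := map_real_smul f hf c 1
  simpa [f] using h

end Parallelogram

/-- A nonnegative function that is homogeneous of degree two and satisfies the parallelogram
inequality is a positive semidefinite quadratic form. -/
theorem exists_posSemidef_of_parallelogram {n : Type*} [Fintype n] [DecidableEq n]
    {V : (n → ℝ) → ℝ} (hnonneg : ∀ x, 0 ≤ V x) (hhom : ∀ (c : ℝ) x, V (c • x) = c ^ 2 * V x)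
    (hpar : ∀ x y, V (x + y) + V (x - y) ≤ 2 * V x + 2 * V y) :
    ∃ P : Matrix n n ℝ, P.PosSemidef ∧ ∀ x, x ⬝ᵥ P *ᵥ x = V x := by
  have hpar' := parallelogram_eq_of_le hhom hpar
  have hneg : ∀ x, V (-x) = V x := fun x => by simpa using hhom (-1) x
  have hsymm : ∀ x y, V (x + y) - V (x - y) = V (y + x) - V (y - x) := fun x y => by
    rw [add_comm, ← neg_sub y x, hneg]
  let D : LinearMap.BilinForm ℝ (n → ℝ) := LinearMap.mk₂ ℝ (fun x y => (V (x + y) - V (x - y)) / 4)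
    (fun x z y => by rw [polar_add_left hhom hpar']; ring)
    (fun c x y => by rw [polar_smul_left hnonneg hhom hpar', smul_eq_mul]; ring)
    (fun x y z => by
      rw [hsymm, polar_add_left hhom hpar', hsymm y, hsymm z]; ring)
    (fun c x y => by
      rw [hsymm, polar_smul_left hnonneg hhom hpar', smul_eq_mul, hsymm y]; ring)
  have hD : ∀ x y, D x y = (V (x + y) - V (x - y)) / 4 := fun x y => rfl
  have hP : ∀ x y, x ⬝ᵥ (LinearMap.BilinForm.toMatrix' D) *ᵥ y = D x y := fun x y => by
    rw [← Matrix.toBilin'_apply', Matrix.toBilin'_toMatrix']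
  have hV : ∀ x, x ⬝ᵥ (LinearMap.BilinForm.toMatrix' D) *ᵥ x = V x := fun x => by
    have h0 : V 0 = 0 := by simpa using hhom 0 0
    rw [hP, hD, sub_self, h0, ← two_smul ℝ x, hhom]
    ring
  refine ⟨LinearMap.BilinForm.toMatrix' D, .of_dotProduct_mulVec_nonneg ?_ fun x => ?_, hV⟩
  · rw [Matrix.IsHermitian, Matrix.conjTranspose_eq_transpose_of_trivial]
    ext i j
    rw [Matrix.transpose_apply, LinearMap.BilinForm.toMatrix'_apply,
      LinearMap.BilinForm.toMatrix'_apply, hD, hD, hsymm]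
  · rw [star_trivial, hV]
    exact hnonneg x

/-! ### Concatenation of signals and trajectories -/

/-- The signal equal to `f` up to time `T` and to `g`, delayed by `T`, afterwards. -/
noncomputable def concat {E : Type*} (T : ℝ) (f g : ℝ → E) (t : ℝ) : E :=
  if t ≤ T then f t else g (t - T)

theorem concat_of_le {E : Type*} {T t : ℝ} (f g : ℝ → E) (h : t ≤ T) : concat T f g t = f t :=
  if_pos h

theorem concat_of_lt {E : Type*} {T t : ℝ} (f g : ℝ → E) (h : T < t) :
    concat T f g t = g (t - T) :=
  if_neg (not_le.2 h)

theorem concat_add {E : Type*} {T s : ℝ} {f g : ℝ → E} (h : f T = g 0) (hs : 0 ≤ s) :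
    concat T f g (T + s) = g s := by
  rcases hs.eq_or_lt with rfl | hs
  · rw [add_zero, concat_of_le _ _ le_rfl, h]
  · rw [concat_of_lt _ _ (by linarith), add_sub_cancel_left]

theorem IsL2e.concat {m : Type*} [Fintype m] {a b : ℝ → m → ℝ} (ha : IsL2e a) (hb : IsL2e b)
    {T : ℝ} : IsL2e (LTI.concat T a b) := by
  intro S
  have h1 : MemLp (LTI.concat T a b) 2 ((volume.restrict (Set.Icc 0 S)).restrict (Set.Iic T)) :=
    ((ha S).restrict (Set.Iic T)).ae_eq <|
      (ae_restrict_iff' measurableSet_Iic).2 (ae_of_all _ fun t ht => (concat_of_le a b ht).symm)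
  have h2 : MemLp (fun t => b (t - T)) 2 (volume.restrict (Set.Icc T S)) := by
    have hmp := (measurePreserving_sub_right (volume : Measure ℝ) T).restrict_preimage
      (s := Set.Icc 0 (S - T)) measurableSet_Icc
    rw [Set.preimage_sub_const_Icc, zero_add, sub_add_cancel] at hmp
    exact (hb (S - T)).comp_measurePreserving hmp
  have h3 : MemLp (LTI.concat T a b) 2 ((volume.restrict (Set.Icc 0 S)).restrict (Set.Iic T)ᶜ) := by
    refine MemLp.ae_eq ((ae_restrict_iff' measurableSet_Iic.compl).2 (ae_of_all _ fun t ht =>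
      (concat_of_lt a b (not_le.1 ht)).symm)) (h2.mono_measure ?_)
    rw [Measure.restrict_restrict measurableSet_Iic.compl]
    exact Measure.restrict_mono (show (Set.Iic T)ᶜ ∩ Set.Icc 0 S ⊆ Set.Icc T S from
      fun t ht => ⟨(Set.notMem_Iic.1 ht.1).le, ht.2.2⟩) le_rfl
  have := MemLp.piecewise measurableSet_Iic h1 h3
  simpa using this

section Integral

variable {E : Type*} [NormedAddCommGroup E] {f g : ℝ → E} {T s : ℝ}

theorem intervalIntegrable_concat_left (hT : 0 ≤ T) (hf : IntervalIntegrable f volume 0 T) :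
    IntervalIntegrable (concat T f g) volume 0 T :=
  hf.congr fun t ht => (concat_of_le f g (by rw [Set.uIoc_of_le hT] at ht; exact ht.2)).symm

theorem intervalIntegrable_concat_right (hs : 0 ≤ s) (hg : IntervalIntegrable g volume 0 s) :
    IntervalIntegrable (concat T f g) volume T (T + s) := by
  have h := hg.comp_sub_right T
  rw [zero_add, add_comm s] at h
  exact h.congr fun t ht =>
    (concat_of_lt f g (by rw [Set.uIoc_of_le (by linarith)] at ht; exact ht.1)).symm

variable [NormedSpace ℝ E]

theorem integral_concat_of_le {t : ℝ} (ht : 0 ≤ t) (htT : t ≤ T) :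
    ∫ τ in (0 : ℝ)..t, concat T f g τ = ∫ τ in (0 : ℝ)..t, f τ :=
  intervalIntegral.integral_congr fun τ hτ => concat_of_le f g <| by
    rw [Set.uIcc_of_le ht] at hτ
    exact hτ.2.trans htT

theorem integral_concat (hT : 0 ≤ T) (hs : 0 ≤ s) (hf : IntervalIntegrable f volume 0 T)
    (hg : IntervalIntegrable g volume 0 s) :
    ∫ τ in (0 : ℝ)..(T + s), concat T f g τ
      = (∫ τ in (0 : ℝ)..T, f τ) + ∫ τ in (0 : ℝ)..s, g τ := by
  rw [← intervalIntegral.integral_add_adjacent_intervals (intervalIntegrable_concat_left hT hf)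
    (intervalIntegrable_concat_right hs hg), integral_concat_of_le hT le_rfl]
  congr 1
  have h : ∫ τ in T..(T + s), concat T f g τ = ∫ τ in T..(T + s), g (τ - T) := by
    -- At τ = T the concatenation still takes the value of f; the half-open interval leaves that
    -- point out.
    refine intervalIntegral.integral_congr_ae (ae_of_all _ fun τ hτ => concat_of_lt f g ?_)
    rw [Set.uIoc_of_le (by linarith)] at hτ
    exact hτ.1
  rw [h, intervalIntegral.integral_comp_sub_right, sub_self, add_sub_cancel_left]

end Integral

theorem continuousOn_concat {E : Type*} [TopologicalSpace E] {f g : ℝ → E} {T : ℝ}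
    (hf : ContinuousOn f (Set.Ici 0)) (hg : ContinuousOn g (Set.Ici 0)) (h : f T = g 0) :
    ContinuousOn (concat T f g) (Set.Ici 0) := by
  refine ContinuousOn.if (p := fun t => t ≤ T) ?_ (hf.mono Set.inter_subset_left) ?_
  · rintro t ⟨-, ht⟩
    have h1 : frontier {t : ℝ | t ≤ T} = {T} := frontier_Iic
    rw [h1, Set.mem_singleton_iff] at ht
    rw [ht, sub_self, h]
  · have h1 : closure {t : ℝ | ¬t ≤ T} = Set.Ici T := by
      have : {t : ℝ | ¬t ≤ T} = Set.Ioi T := by ext; simp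
      rw [this, closure_Ioi]
    rw [h1]
    exact hg.comp (by fun_prop) fun t ht => Set.mem_Ici.2 (sub_nonneg.2 ht.2)

section Trajectory

variable {n m : Type*} [Fintype n] [Fintype m] {A : Matrix n n ℝ} {B : Matrix n m ℝ}

theorem IsTrajectory.apply_zero {x₀ : n → ℝ} {a : ℝ → m → ℝ} {x : ℝ → n → ℝ}
    (h : IsTrajectory A B x₀ a x) : x 0 = x₀ := by
  rw [h.2 0 le_rfl, intervalIntegral.integral_same, add_zero]

theorem IsTrajectory.concat {x₀ : n → ℝ} {a b : ℝ → m → ℝ} {x y : ℝ → n → ℝ} {T : ℝ} (hT : 0 ≤ T)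
    (ha : IsL2e a) (hb : IsL2e b) (hx : IsTrajectory A B x₀ a x)
    (hy : IsTrajectory A B (x T) b y) :
    IsTrajectory A B x₀ (LTI.concat T a b) (LTI.concat T x y) := by
  refine ⟨continuousOn_concat hx.1 hy.1 hy.apply_zero.symm, fun t ht => ?_⟩
  have hv : (fun τ => A *ᵥ LTI.concat T x y τ + B *ᵥ LTI.concat T a b τ)
      = LTI.concat T (fun τ => A *ᵥ x τ + B *ᵥ a τ) (fun τ => A *ᵥ y τ + B *ᵥ b τ) := by
    funext τ
    unfold LTI.concat
    split_ifs <;> rfl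
  rw [hv]
  rcases le_or_gt t T with h | h
  · rw [integral_concat_of_le ht h, concat_of_le _ _ h, hx.2 t ht]
  · obtain ⟨s, rfl⟩ : ∃ s, t = T + s := ⟨t - T, by ring⟩
    have hs : 0 ≤ s := by linarith
    rw [integral_concat hT hs (intervalIntegrable_velocity A B ha hx.1 hT)
      (intervalIntegrable_velocity A B hb hy.1 hs), concat_add hy.apply_zero.symm hs, hy.2 s hs,
      hx.2 T hT, add_assoc]

theorem isTrajectory_zero : IsTrajectory A B 0 0 0 :=
  ⟨continuousOn_const, fun t _ => by simp⟩

theorem isL2e_zero : IsL2e (0 : ℝ → m → ℝ) := continuous_const.isL2e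

theorem IsL2e.add {a b : ℝ → m → ℝ} (ha : IsL2e a) (hb : IsL2e b) : IsL2e (a + b) :=
  fun T => (ha T).add (hb T)

theorem IsL2e.smul {a : ℝ → m → ℝ} (ha : IsL2e a) (c : ℝ) : IsL2e (c • a) :=
  fun T => (ha T).const_smul c

theorem IsTrajectory.add {x₀ y₀ : n → ℝ} {a b : ℝ → m → ℝ} {x y : ℝ → n → ℝ}
    (ha : IsL2e a) (hb : IsL2e b) (hx : IsTrajectory A B x₀ a x) (hy : IsTrajectory A B y₀ b y) :
    IsTrajectory A B (x₀ + y₀) (a + b) (x + y) := by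
  refine ⟨hx.1.add hy.1, fun t ht => ?_⟩
  have h : (fun s => A *ᵥ (x + y) s + B *ᵥ (a + b) s)
      = fun s => (A *ᵥ x s + B *ᵥ a s) + (A *ᵥ y s + B *ᵥ b s) := by
    funext s
    rw [Pi.add_apply, Pi.add_apply, Matrix.mulVec_add, Matrix.mulVec_add]
    abel
  rw [h, intervalIntegral.integral_add (intervalIntegrable_velocity A B ha hx.1 ht)
    (intervalIntegrable_velocity A B hb hy.1 ht), Pi.add_apply, hx.2 t ht, hy.2 t ht]
  abel

theorem IsTrajectory.smul {x₀ : n → ℝ} {a : ℝ → m → ℝ} {x : ℝ → n → ℝ}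
    (hx : IsTrajectory A B x₀ a x) (c : ℝ) :
    IsTrajectory A B (c • x₀) (c • a) (c • x) := by
  refine ⟨hx.1.const_smul c, fun t ht => ?_⟩
  have h : (fun s => A *ᵥ (c • x) s + B *ᵥ (c • a) s) = fun s => c • (A *ᵥ x s + B *ᵥ a s) := by
    funext s
    rw [Pi.smul_apply, Pi.smul_apply, Matrix.mulVec_smul, Matrix.mulVec_smul, smul_add]
  rw [h, intervalIntegral.integral_smul, Pi.smul_apply, hx.2 t ht, smul_add]

end Trajectory

/-! ### Smooth trajectories through a given state and input -/

section Exponential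

attribute [local instance] Matrix.linftyOpNormedRing Matrix.linftyOpNormedAlgebra

theorem exists_hasDerivAt_mulVec {n : Type*} [Fintype n] [DecidableEq n] (M : Matrix n n ℝ)
    (ζ : n → ℝ) : ∃ z : ℝ → n → ℝ, z 0 = ζ ∧ ∀ t, HasDerivAt z (M *ᵥ z t) t := by
  have : CompleteSpace (Matrix n n ℝ) := FiniteDimensional.complete ℝ _
  refine ⟨fun t => NormedSpace.exp (t • M) *ᵥ ζ, by simp, fun t => ?_⟩
  let L : Matrix n n ℝ →L[ℝ] (n → ℝ) :=
    LinearMap.toContinuousLinearMap ((Matrix.mulVecBilin ℝ ℝ).flip ζ)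
  have h := L.hasFDerivAt.comp_hasDerivAt t (hasDerivAt_exp_smul_const' M t)
  rw [Matrix.mulVec_mulVec]
  exact h

end Exponential

section Trajectory

variable {n m : Type*} [Fintype n] [DecidableEq n] [Fintype m] [DecidableEq m]

/-- Through every state and input value passes a smooth trajectory. -/
theorem exists_isTrajectory (A : Matrix n n ℝ) (B : Matrix n m ℝ) (ξ : n → ℝ) (α : m → ℝ) :
    ∃ (a : ℝ → m → ℝ) (x : ℝ → n → ℝ), Continuous a ∧ Continuous x ∧ a 0 = α ∧
      IsTrajectory A B ξ a x ∧ HasDerivAt x (A *ᵥ ξ + B *ᵥ α) 0 := by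
  -- The input is adjoined to the state with zero derivative, so a constant input α becomes part of
  -- one autonomous linear flow.
  obtain ⟨z, hz0, hz⟩ := exists_hasDerivAt_mulVec (Matrix.fromBlocks A B 0 0) (Sum.elim ξ α)
  have hzc : Continuous z := continuous_iff_continuousAt.2 fun t => (hz t).continuousAt
  have hx : ∀ t, HasDerivAt (fun t i => z t (Sum.inl i))
      (A *ᵥ (z t ∘ Sum.inl) + B *ᵥ (z t ∘ Sum.inr)) t := by
    refine fun t => hasDerivAt_pi.2 fun i => ?_
    have h := hasDerivAt_pi.1 (hz t) (Sum.inl i)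
    rwa [Matrix.fromBlocks_mulVec] at h
  have hac : Continuous (fun t i => z t (Sum.inr i)) := by fun_prop
  have hxc : Continuous (fun t i => z t (Sum.inl i)) := by fun_prop
  refine ⟨_, _, hac, hxc, by rw [hz0]; rfl, ⟨hxc.continuousOn, fun t ht => ?_⟩, ?_⟩
  · have h := intervalIntegral.integral_eq_sub_of_hasDerivAt (fun s _ => hx s)
      (intervalIntegrable_velocity A B hac.isL2e hxc.continuousOn ht)
    have h0 : (fun i => z 0 (Sum.inl i)) = ξ := by rw [hz0]; rfl
    rw [h0] at h
    exact (add_eq_of_eq_sub' h).symm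
  · have h := hx 0
    rwa [hz0, Sum.elim_comp_inl, Sum.elim_comp_inr] at h

end Trajectory

/-! ### The required supply as a quadratic storage function -/

section RequiredSupply

variable {n m p r : Type*} [Fintype n] [Fintype m] [Fintype p] [Fintype r]
  (A : Matrix n n ℝ) (B : Matrix n m ℝ) (Cp : Matrix p n ℝ) (Cr : Matrix r n ℝ) (γ₁ γ₂ : ℝ)

/-- The supplies needed to steer the origin to `ξ` in time `T`. -/
def supplies (T : ℝ) (ξ : n → ℝ) : Set ℝ :=
  {c | ∃ (a : ℝ → m → ℝ) (x : ℝ → n → ℝ), IsL2e a ∧ IsTrajectory A B 0 a x ∧ x T = ξ ∧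
    c = ∫ t in (0 : ℝ)..T, supply Cp Cr γ₁ γ₂ (x t) (a t)}

/-- The required supply: the infimal supply needed to steer the origin to `ξ`. -/
noncomputable def requiredSupply (ξ : n → ℝ) : ℝ :=
  sInf {c | ∃ T : ℝ, 0 ≤ T ∧ c ∈ supplies A B Cp Cr γ₁ γ₂ T ξ}

variable {A B Cp Cr γ₁ γ₂}

theorem concat_mem_supplies {T s : ℝ} (hT : 0 ≤ T) (hs : 0 ≤ s) {ξ : n → ℝ} {c : ℝ}
    (hc : c ∈ supplies A B Cp Cr γ₁ γ₂ T ξ) {b : ℝ → m → ℝ} {y : ℝ → n → ℝ} (hb : IsL2e b)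
    (hy : IsTrajectory A B ξ b y) :
    c + ∫ t in (0 : ℝ)..s, supply Cp Cr γ₁ γ₂ (y t) (b t)
      ∈ supplies A B Cp Cr γ₁ γ₂ (T + s) (y s) := by
  obtain ⟨a, x, ha, hx, rfl, rfl⟩ := hc
  refine ⟨_, _, ha.concat hb, hx.concat hT ha hb hy, concat_add hy.apply_zero.symm hs, ?_⟩
  rw [← integral_concat hT hs (intervalIntegrable_supply Cp Cr γ₁ γ₂ ha hx.1 hT)
    (intervalIntegrable_supply Cp Cr γ₁ γ₂ hb hy.1 hs)]
  congr 1
  funext t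
  unfold concat
  split_ifs <;> rfl

theorem supply_zero : supply Cp Cr γ₁ γ₂ 0 (0 : m → ℝ) = 0 := by simp [supply]

theorem zero_mem_supplies (T : ℝ) : (0 : ℝ) ∈ supplies A B Cp Cr γ₁ γ₂ T 0 :=
  ⟨0, 0, isL2e_zero, isTrajectory_zero, rfl, by simp [supply_zero]⟩

/-- Resting at the origin for time T' - T before steering costs nothing. This lets two steerings be
compared on a common horizon. -/
theorem supplies_mono {T T' : ℝ} (hT : 0 ≤ T) (h : T ≤ T') (ξ : n → ℝ) :
    supplies A B Cp Cr γ₁ γ₂ T ξ ⊆ supplies A B Cp Cr γ₁ γ₂ T' ξ := by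
  rintro c ⟨a, x, ha, hx, rfl, rfl⟩
  have h1 := concat_mem_supplies (sub_nonneg.2 h) hT
    (zero_mem_supplies (A := A) (B := B) (Cp := Cp) (Cr := Cr) (γ₁ := γ₁) (γ₂ := γ₂) (T' - T))
    ha hx
  rwa [zero_add, sub_add_cancel] at h1

theorem supply_smul (c : ℝ) (x : n → ℝ) (a : m → ℝ) :
    supply Cp Cr γ₁ γ₂ (c • x) (c • a) = c ^ 2 * supply Cp Cr γ₁ γ₂ x a := by
  simp only [supply, Matrix.mulVec_smul, smul_dotProduct, dotProduct_smul, smul_eq_mul]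
  ring

theorem supply_parallelogram (x y : n → ℝ) (a b : m → ℝ) :
    supply Cp Cr γ₁ γ₂ (x + y) (a + b) + supply Cp Cr γ₁ γ₂ (x + (-1 : ℝ) • y) (a + (-1 : ℝ) • b)
      = 2 * supply Cp Cr γ₁ γ₂ x a + 2 * supply Cp Cr γ₁ γ₂ y b := by
  simp only [supply, Matrix.mulVec_smul, Matrix.mulVec_add, smul_dotProduct, dotProduct_smul,
    add_dotProduct, dotProduct_add, smul_eq_mul]
  ring

theorem smul_mem_supplies {T : ℝ} {ξ : n → ℝ} {c : ℝ}
    (hc : c ∈ supplies A B Cp Cr γ₁ γ₂ T ξ) (k : ℝ) :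
    k ^ 2 * c ∈ supplies A B Cp Cr γ₁ γ₂ T (k • ξ) := by
  obtain ⟨a, x, ha, hx, rfl, rfl⟩ := hc
  refine ⟨k • a, k • x, ha.smul k, by simpa using hx.smul k, rfl, ?_⟩
  simp only [Pi.smul_apply, supply_smul, intervalIntegral.integral_const_mul]

/-- The sum and the difference of the two steerings are again trajectories from the origin, and the
supply satisfies the parallelogram law pointwise. -/
theorem exists_supplies_parallelogram {T : ℝ} (hT : 0 ≤ T) {ξ η : n → ℝ} {c d : ℝ}
    (hc : c ∈ supplies A B Cp Cr γ₁ γ₂ T ξ) (hd : d ∈ supplies A B Cp Cr γ₁ γ₂ T η) :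
    ∃ c' ∈ supplies A B Cp Cr γ₁ γ₂ T (ξ + η), ∃ d' ∈ supplies A B Cp Cr γ₁ γ₂ T (ξ - η),
      c' + d' = 2 * c + 2 * d := by
  obtain ⟨a, x, ha, hx, rfl, rfl⟩ := hc
  obtain ⟨b, y, hb, hy, rfl, rfl⟩ := hd
  have hb' := hb.smul (-1)
  have hy' := hy.smul (-1)
  have hx1 := hx.add ha hb hy
  have hx2 := hx.add ha hb' hy'
  rw [add_zero] at hx1
  rw [smul_zero, add_zero] at hx2
  refine ⟨_, ⟨_, _, ha.add hb, hx1, rfl, rfl⟩, _, ⟨_, _, ha.add hb', hx2, ?_, rfl⟩, ?_⟩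
  · rw [Pi.add_apply, Pi.smul_apply, neg_one_smul, sub_eq_add_neg]
  · rw [← intervalIntegral.integral_const_mul, ← intervalIntegral.integral_const_mul,
      ← intervalIntegral.integral_add (intervalIntegrable_supply Cp Cr γ₁ γ₂ (ha.add hb) hx1.1 hT)
        (intervalIntegrable_supply Cp Cr γ₁ γ₂ (ha.add hb') hx2.1 hT),
      ← intervalIntegral.integral_add
        ((intervalIntegrable_supply Cp Cr γ₁ γ₂ ha hx.1 hT).const_mul 2)
        ((intervalIntegrable_supply Cp Cr γ₁ γ₂ hb hy.1 hT).const_mul 2)]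
    refine intervalIntegral.integral_congr fun t _ => ?_
    exact supply_parallelogram (x t) (y t) (a t) (b t)

/-- Controllability enters here: over an empty set the real infimum would be the default value 0,
and V would carry no information. -/
theorem IsControllable.supplies_nonempty (hAB : IsControllable A B) (ξ : n → ℝ) :
    {c | ∃ T : ℝ, 0 ≤ T ∧ c ∈ supplies A B Cp Cr γ₁ γ₂ T ξ}.Nonempty := by
  obtain ⟨T, hT, a, x, ha, hx, hxT⟩ := hAB 0 ξ
  exact ⟨_, T, hT, a, x, ha, hx, hxT, rfl⟩

theorem DualFeasible.nonneg_of_mem_supplies (h : DualFeasible A B Cp Cr γ₁ γ₂) {T : ℝ}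
    (hT : 0 ≤ T) {ξ : n → ℝ} {c : ℝ} (hc : c ∈ supplies A B Cp Cr γ₁ γ₂ T ξ) : 0 ≤ c := by
  obtain ⟨a, x, ha, hx, -, rfl⟩ := hc
  rw [integral_supply Cp Cr γ₁ γ₂ ha hx.1 hT]
  linarith [h.2.2 a x ha hx T hT]

theorem DualFeasible.requiredSupply_le (h : DualFeasible A B Cp Cr γ₁ γ₂) {T : ℝ}
    (hT : 0 ≤ T) {ξ : n → ℝ} {c : ℝ} (hc : c ∈ supplies A B Cp Cr γ₁ γ₂ T ξ) :
    requiredSupply A B Cp Cr γ₁ γ₂ ξ ≤ c :=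
  csInf_le ⟨0, fun _ ⟨_, hT, hc⟩ => h.nonneg_of_mem_supplies hT hc⟩ ⟨T, hT, hc⟩

theorem DualFeasible.requiredSupply_nonneg (h : DualFeasible A B Cp Cr γ₁ γ₂) (ξ : n → ℝ) :
    0 ≤ requiredSupply A B Cp Cr γ₁ γ₂ ξ :=
  Real.sInf_nonneg fun _ ⟨_, hT, hc⟩ => h.nonneg_of_mem_supplies hT hc

theorem le_requiredSupply (hAB : IsControllable A B) {ξ : n → ℝ} {v : ℝ}
    (h : ∀ T, 0 ≤ T → ∀ c ∈ supplies A B Cp Cr γ₁ γ₂ T ξ, v ≤ c) :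
    v ≤ requiredSupply A B Cp Cr γ₁ γ₂ ξ :=
  le_csInf (hAB.supplies_nonempty ξ) fun c ⟨T, hT, hc⟩ => h T hT c hc

theorem DualFeasible.requiredSupply_smul (h : DualFeasible A B Cp Cr γ₁ γ₂)
    (hAB : IsControllable A B) (k : ℝ) (ξ : n → ℝ) :
    requiredSupply A B Cp Cr γ₁ γ₂ (k • ξ) = k ^ 2 * requiredSupply A B Cp Cr γ₁ γ₂ ξ := by
  rcases eq_or_ne k 0 with rfl | hk
  · rw [zero_smul, zero_pow two_ne_zero, zero_mul]
    exact le_antisymm (h.requiredSupply_le le_rfl (zero_mem_supplies 0))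
      (h.requiredSupply_nonneg 0)
  have key : ∀ (k : ℝ) (_ : k ≠ 0) (ξ : n → ℝ),
      requiredSupply A B Cp Cr γ₁ γ₂ (k • ξ) ≤ k ^ 2 * requiredSupply A B Cp Cr γ₁ γ₂ ξ := by
    intro k hk ξ
    have hk2 : 0 < k ^ 2 := by positivity
    rw [← div_le_iff₀' hk2]
    refine le_requiredSupply hAB fun T hT c hc => ?_
    rw [div_le_iff₀' hk2]
    exact h.requiredSupply_le hT (smul_mem_supplies hc k)
  refine le_antisymm (key k hk ξ) ?_
  -- Scaling back by k⁻¹ gives the reverse inequality.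
  have h1 := key k⁻¹ (inv_ne_zero hk) (k • ξ)
  rw [smul_smul, inv_mul_cancel₀ hk, one_smul, inv_pow, inv_mul_eq_div,
    le_div_iff₀' (by positivity)] at h1
  exact h1

theorem DualFeasible.requiredSupply_parallelogram (h : DualFeasible A B Cp Cr γ₁ γ₂)
    (hAB : IsControllable A B) (ξ η : n → ℝ) :
    requiredSupply A B Cp Cr γ₁ γ₂ (ξ + η) + requiredSupply A B Cp Cr γ₁ γ₂ (ξ - η)
      ≤ 2 * requiredSupply A B Cp Cr γ₁ γ₂ ξ + 2 * requiredSupply A B Cp Cr γ₁ γ₂ η := by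
  set V := requiredSupply A B Cp Cr γ₁ γ₂
  -- The two infima on the right are taken one after the other: over d with c fixed, then over c.
  have h1 : (V (ξ + η) + V (ξ - η) - 2 * V η) / 2 ≤ V ξ := by
    refine le_requiredSupply hAB fun T hT c hc => ?_
    have h2 : (V (ξ + η) + V (ξ - η) - 2 * c) / 2 ≤ V η := by
      refine le_requiredSupply hAB fun S hS d hd => ?_
      obtain ⟨c', hc', d', hd', e⟩ := exists_supplies_parallelogram (le_max_of_le_left hT)
        (supplies_mono hT (le_max_left T S) ξ hc) (supplies_mono hS (le_max_right T S) η hd)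
      have h3 : V (ξ + η) ≤ c' := h.requiredSupply_le (le_max_of_le_left hT) hc'
      have h4 : V (ξ - η) ≤ d' := h.requiredSupply_le (le_max_of_le_left hT) hd'
      linarith
    linarith
  linarith

/-- The required supply is a storage function. -/
theorem DualFeasible.requiredSupply_trajectory_le (h : DualFeasible A B Cp Cr γ₁ γ₂)
    (hAB : IsControllable A B) {ξ : n → ℝ} {a : ℝ → m → ℝ} {x : ℝ → n → ℝ} (ha : IsL2e a)
    (hx : IsTrajectory A B ξ a x) {t : ℝ} (ht : 0 ≤ t) :
    requiredSupply A B Cp Cr γ₁ γ₂ (x t) ≤ requiredSupply A B Cp Cr γ₁ γ₂ ξ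
      + ∫ s in (0 : ℝ)..t, supply Cp Cr γ₁ γ₂ (x s) (a s) := by
  rw [← sub_le_iff_le_add]
  refine le_requiredSupply hAB fun T hT c hc => ?_
  rw [sub_le_iff_le_add]
  exact h.requiredSupply_le (add_nonneg hT ht) (concat_mem_supplies hT ht hc ha hx)

theorem continuous_supply {X : Type*} [TopologicalSpace X] {x : X → n → ℝ} {a : X → m → ℝ}
    (hx : Continuous x) (ha : Continuous a) :
    Continuous fun t => supply Cp Cr γ₁ γ₂ (x t) (a t) := by
  have h1 := (continuous_const (y := Cr)).matrix_mulVec hx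
  have h2 := (continuous_const (y := Cp)).matrix_mulVec hx
  exact (((h1.dotProduct h1).const_mul γ₁).add
    ((ha.dotProduct ha).const_mul γ₂)).sub (h2.dotProduct h2)

end RequiredSupply

/-! ### From (D) to (S), and equality of the values -/

theorem nonneg_of_hasDerivAt_of_forall_nonneg {φ : ℝ → ℝ} {d : ℝ} (h : HasDerivAt φ d 0)
    (h0 : φ 0 = 0) (hφ : ∀ t, 0 ≤ t → 0 ≤ φ t) : 0 ≤ d := by
  have h1 := (hasDerivWithinAt_iff_tendsto_slope' (s := Set.Ioi (0 : ℝ)) (by simp)).1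
    h.hasDerivWithinAt
  refine ge_of_tendsto h1 ?_
  filter_upwards [self_mem_nhdsWithin] with t ht
  rw [slope_def_field, h0, sub_zero, sub_zero]
  exact div_nonneg (hφ t (le_of_lt ht)) (le_of_lt ht)

theorem hasDerivAt_dotProduct_mulVec {n : Type*} [Fintype n] {P : Matrix n n ℝ} (hP : Pᵀ = P)
    {x : ℝ → n → ℝ} {v : n → ℝ} {t : ℝ} (hx : HasDerivAt x v t) :
    HasDerivAt (fun s => x s ⬝ᵥ P *ᵥ x s) (2 * (x t ⬝ᵥ P *ᵥ v)) t := by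
  have h1 : HasDerivAt (fun s => P *ᵥ x s) (P *ᵥ v) t :=
    (LinearMap.toContinuousLinearMap (Matrix.mulVecLin P)).hasFDerivAt.comp_hasDerivAt t hx
  have h2 : HasDerivAt (fun s => ∑ i, x s i * (P *ᵥ x s) i)
      (∑ i, (v i * (P *ᵥ x t) i + x t i * (P *ᵥ v) i)) t :=
    HasDerivAt.fun_sum fun i _ => (hasDerivAt_pi.1 hx i).mul (hasDerivAt_pi.1 h1 i)
  have h3 : ∑ i, (v i * (P *ᵥ x t) i + x t i * (P *ᵥ v) i) = 2 * (x t ⬝ᵥ P *ᵥ v) := by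
    rw [Finset.sum_add_distrib, two_mul]
    exact congrArg (· + _) (dotProduct_mulVec_comm_of_isSymm hP _ _)
  rwa [h3] at h2

section Main

variable {n m p r : Type*} [Fintype n] [DecidableEq n] [Fintype m] [DecidableEq m]
  [Fintype p] [Fintype r] {A : Matrix n n ℝ} {B : Matrix n m ℝ} {Cp : Matrix p n ℝ}
  {Cr : Matrix r n ℝ} {γ₁ γ₂ : ℝ}

/-- Dissipativity of a controllable system from the origin yields a positive semidefinite
quadratic storage function. -/
theorem DualFeasible.exists_posSemidef (h : DualFeasible A B Cp Cr γ₁ γ₂)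
    (hAB : IsControllable A B) :
    ∃ P : Matrix n n ℝ, P.PosSemidef ∧
      ∀ x a, 2 * (x ⬝ᵥ P *ᵥ (A *ᵥ x + B *ᵥ a)) ≤ supply Cp Cr γ₁ γ₂ x a := by
  obtain ⟨P, hP, hPV⟩ := exists_posSemidef_of_parallelogram h.requiredSupply_nonneg
    (h.requiredSupply_smul hAB) (h.requiredSupply_parallelogram hAB)
  refine ⟨P, hP, fun ξ α => ?_⟩
  have hPt : Pᵀ = P := by
    rw [← Matrix.conjTranspose_eq_transpose_of_trivial]; exact hP.isHermitian
  obtain ⟨a, x, hac, hxc, ha0, hx, hd⟩ := exists_isTrajectory A B ξ α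
  have hx0 := hx.apply_zero
  have hs : Continuous fun t => supply Cp Cr γ₁ γ₂ (x t) (a t) :=
    continuous_supply hxc hac
  have h1 := (hs.integral_hasStrictDerivAt 0 0).hasDerivAt
  have h2 := hasDerivAt_dotProduct_mulVec hPt hd
  rw [hx0, ha0] at h1
  rw [hx0] at h2
  -- The slack in the integrated dissipation inequality vanishes at t = 0 and is nonnegative
  -- afterwards, so its derivative at 0, the slack in the pointwise inequality at (ξ, α), is
  -- nonnegative.
  have h3 : HasDerivAt (fun t => ξ ⬝ᵥ P *ᵥ ξ
      + (∫ s in (0 : ℝ)..t, supply Cp Cr γ₁ γ₂ (x s) (a s)) - x t ⬝ᵥ P *ᵥ x t)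
      (supply Cp Cr γ₁ γ₂ ξ α - 2 * (ξ ⬝ᵥ P *ᵥ (A *ᵥ ξ + B *ᵥ α))) 0 :=
    (h1.const_add (ξ ⬝ᵥ P *ᵥ ξ)).sub h2
  refine sub_nonneg.1 (nonneg_of_hasDerivAt_of_forall_nonneg h3 ?_ fun t ht => ?_)
  · rw [intervalIntegral.integral_same, hx0, add_zero, sub_self]
  · have h4 := h.requiredSupply_trajectory_le hAB hac.isL2e hx ht
    rw [← hPV, ← hPV] at h4
    exact sub_nonneg.2 h4

theorem DualFeasible.exists_sdpFeasible (h : DualFeasible A B Cp Cr γ₁ γ₂) (hA : IsHurwitz A)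
    (hAB : IsControllable A B) {ε : ℝ} (hε : 0 < ε) :
    ∃ P : Matrix n n ℝ, SDPFeasible A B Cp Cr P γ₁ (γ₂ + ε) := by
  obtain ⟨P, hP, hPs⟩ := h.exists_posSemidef hAB
  exact hA.exists_sdpFeasible_add hP h.1 h.2.1 hPs hε

theorem dualValue_eq_sdpValue (hA : IsHurwitz A) (hAB : IsControllable A B) (εr εa : ℝ) :
    dualValue A B Cp Cr εr εa = sdpValue A B Cp Cr εr εa := by
  refine le_antisymm (sInf_le_sInf ?_) (le_sInf ?_)
  · rintro _ ⟨P, γ₁, γ₂, h, rfl⟩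
    exact ⟨γ₁, γ₂, h.dualFeasible, rfl⟩
  · rintro _ ⟨γ₁, γ₂, h, rfl⟩
    have hlim : Filter.Tendsto (fun ε : ℝ => ((εr * γ₁ + εa * (γ₂ + ε) : ℝ) : EReal))
        (nhdsWithin 0 (Set.Ioi 0)) (nhds ((εr * γ₁ + εa * γ₂ : ℝ) : EReal)) := by
      refine (continuous_coe_real_ereal.tendsto _).comp ?_
      have hc : Continuous fun ε : ℝ => εr * γ₁ + εa * (γ₂ + ε) := by fun_prop
      simpa using (hc.tendsto 0).mono_left nhdsWithin_le_nhds
    refine ge_of_tendsto hlim ?_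
    filter_upwards [self_mem_nhdsWithin] with ε hε
    obtain ⟨P, hP⟩ := h.exists_sdpFeasible hA hAB hε
    exact sInf_le ⟨P, γ₁, γ₂ + ε, hP, rfl⟩

end Main

end LTI

theorem lemma2 {n m p r : Type*} [Fintype n] [DecidableEq n] [Fintype m] [DecidableEq m]
    [Fintype p] [Fintype r]
    (A : Matrix n n ℝ) (B : Matrix n m ℝ) (Cp : Matrix p n ℝ) (Cr : Matrix r n ℝ)
    (hA : LTI.IsHurwitz A) (hAB : LTI.IsControllable A B) :
    -- the semidefinite program is feasible
    (∃ (P : Matrix n n ℝ) (γ₁ γ₂ : ℝ), LTI.SDPFeasible A B Cp Cr P γ₁ γ₂) ∧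
    -- a feasible point of the semidefinite program gives a feasible point of the dual problem
    (∀ (P : Matrix n n ℝ) (γ₁ γ₂ : ℝ),
      LTI.SDPFeasible A B Cp Cr P γ₁ γ₂ → LTI.DualFeasible A B Cp Cr γ₁ γ₂) ∧
    -- conversely, up to an arbitrarily small increase of `γ₂`
    (∀ γ₁ γ₂ : ℝ, LTI.DualFeasible A B Cp Cr γ₁ γ₂ →
      ∀ ε : ℝ, 0 < ε → ∃ P : Matrix n n ℝ, LTI.SDPFeasible A B Cp Cr P γ₁ (γ₂ + ε)) ∧
    -- the two problems have the same optimal value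
    (∀ εr εa : ℝ, 0 ≤ εr → 0 ≤ εa →
      LTI.dualValue A B Cp Cr εr εa = LTI.sdpValue A B Cp Cr εr εa) := by
  exact ⟨hA.exists_sdpFeasible B Cp Cr, fun _ _ _ h => h.dualFeasible,
    fun _ _ h _ hε => h.exists_sdpFeasible hA hAB hε,
    fun εr εa _ _ => LTI.dualValue_eq_sdpValue hA hAB εr εa⟩
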